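/- **Theorem (Goldberg's formula).** Let $x_1<x_2<\cdots$ be noncommuting variables and consider formal series in them with coefficients indexed by words. A word $u$ is packed if the set of its letters is $\{x_1,\dots,x_p\}$ for some $p\ge 0$; ${\rm pack}(w)$ is the packed word obtained from $w$ by replacing its letters $b_1<\cdots<b_p$ by $x_1,\dots,x_p$, and $\mathbf M_u=\sum_{{\rm pack}(w)=u}w$. Let $$\hat\sigma_1=e^{x_1}e^{x_2}e^{x_3}\cdots,\qquad \Phi=\log\hat\sigma_1=\sum_{n\ge 1}\frac{(-1)^{n-1}}{n}(\hat\sigma_1-1)^n$$ (the Hausdorff series). For a word $u$, let $d(u)$ and $r(u)$ be the numbers of strict descents ($u_i>u_{i+1}$) and strict rises ($u_i<u_{i+1}$) of $u$, let $u=i_1^{j_1}i_2^{j_2}\cdots i_s^{j_s}$ be the factorization of $u$ into maximal blocks of identical letters, and let $$E_n(x,y)=\sum_{\sigma\in\mathfrak S_n}x^{d(\sigma)}y^{r(\sigma)},\qquad r(\sigma)=n-1-d(\sigma)\quad(n\ge 1),$$ be the homogeneous Eulerian polynomial, where $d(\sigma)$ and $r(\sigma)$ are the numbers of descents and rises of $\sigma$.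 (1) There is a unique family $(c_u)$ of rational numbers, indexed by the packed words, with $\Phi=\sum_u c_u\mathbf M_u$, and for every nonempty packed word $u$ $$c_u=\int_{-1}^0 t^{d(u)+1}(1+t)^{r(u)}\prod_{k=1}^s\frac{E_{j_k}(t,1+t)}{j_k!}\,\frac{dt}{t}.$$ (2) More generally, let $m$ be a positive or signed, possibly infinite, measure on $\mathbb R$, of the form $dm=\rho\,d\mu$ with $\mu$ a positive measure and $\rho$ a real function, such that $t^n$ is absolutely integrable for $m$ (that is, $t^n\rho(t)$ is $\mu$-integrable) for all $n\ge 1$, and let $f(z)=\sum_{n\ge 1}f_nz^n$ with $f_n=\int_{\mathbb R}t^n\,dm(t)$. Then there is a unique family $(c_u)$ of real numbers with $f(\hat\sigma_1-1)=\sum_{n\ge1}f_n(\hat\sigma_1-1)^n=\sum_u c_u\mathbf M_u$, and for every nonempty packed word $u$ $$c_u=\int_{\mathbb R} t^{d(u)+1}(1+t)^{r(u)}\prod_{k=1}^s\frac{E_{j_k}(t,1+t)}{j_k!}\,dm(t),$$ and all these integrals converge absolutely. -/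

import Mathlib

open scoped PowerSeries

/-- Noncommutative formal power series over `R` in the letters `x_1 < x_2 < ⋯` (indexed by `ℕ+`):
a series is the family of its coefficients, indexed by all words. -/
def NCSeries (R : Type*) : Type _ := List ℕ+ → R

namespace NCSeries

section Algebra

variable {R : Type*} [CommRing R]

/-- The series `1`, supported on the empty word. -/
instance : One (NCSeries R) := ⟨fun w => if w = [] then 1 else 0⟩

/-- Coefficientwise subtraction. -/
instance : Sub (NCSeries R) := ⟨fun F G w => F w - G w⟩

/-- The concatenation product: the coefficient of `w` in `F * G` is the sum of `F u * G v` over all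
the factorizations `w = uv`. -/
instance : Mul (NCSeries R) :=
  ⟨fun F G w => ∑ i ∈ Finset.range (w.length + 1), F (w.take i) * G (w.drop i)⟩

/-- Powers: `F ^ 0 = 1` and `F ^ (n + 1) = F ^ n * F`. -/
instance : Pow (NCSeries R) ℕ := ⟨fun F n => npowRec n F⟩

/-- The letter `x_i`, as a series. -/
def letter (i : ℕ+) : NCSeries R := fun w => if w = [i] then 1 else 0

/-- Substitution `f(F) = ∑ n, f_n F ^ n` of a series `F` without constant term into a one-variable
power series `f`. Each coefficient is a finite sum, see `pow_apply_eq_zero`. -/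
noncomputable def subst (f : R⟦X⟧) (F : NCSeries R) : NCSeries R :=
  fun w => ∑ᶠ n : ℕ, PowerSeries.coeff n f * (F ^ n) w

theorem mul_apply (F G : NCSeries R) (w : List ℕ+) :
    (F * G) w = ∑ i ∈ Finset.range (w.length + 1), F (w.take i) * G (w.drop i) := rfl

theorem one_apply (w : List ℕ+) : (1 : NCSeries R) w = if w = [] then 1 else 0 := rfl

theorem pow_zero_apply (F : NCSeries R) (w : List ℕ+) : (F ^ 0) w = if w = [] then 1 else 0 := rfl

theorem pow_succ_eq (F : NCSeries R) (n : ℕ) : F ^ (n + 1) = F ^ n * F := rfl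

theorem pow_apply_eq_zero (F : NCSeries R) (hF : F [] = 0) (n : ℕ) :
    ∀ w : List ℕ+, w.length < n → (F ^ n) w = 0 := by
  induction n with
  | zero => intro w hw; omega
  | succ n ih =>
    intro w hw
    rw [pow_succ_eq, mul_apply]
    refine Finset.sum_eq_zero fun i hi => ?_
    have hi' : i ≤ w.length := by simpa [Nat.lt_succ_iff] using hi
    rcases Nat.lt_or_ge i n with h | h
    · rw [ih _ (by rw [List.length_take]; omega), zero_mul]
    · have : w.drop i = [] := by rw [List.drop_eq_nil_iff]; omega
      rw [this, hF, mul_zero]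

/-- If `G` has constant term `1` and no other monomial made only of letters of `w`, then
right multiplication by `G` does not change the coefficient of `w`. -/
theorem mul_apply_eq_left (F G : NCSeries R) (w : List ℕ+) (h1 : G [] = 1)
    (h : ∀ v : List ℕ+, v ≠ [] → (∀ a ∈ v, a ∈ w) → G v = 0) : (F * G) w = F w := by
  rw [mul_apply, Finset.sum_range_succ, List.take_length, List.drop_length, h1, mul_one,
    Finset.sum_eq_zero, zero_add]
  intro i hi
  rw [h _ _ fun a ha => List.mem_of_mem_drop ha, mul_zero]
  rw [Ne, List.drop_eq_nil_iff]
  simpa using hi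

theorem letter_pow_apply_eq_zero (i : ℕ+) (n : ℕ) :
    ∀ v : List ℕ+, v ≠ [] → i ∉ v → ((letter i : NCSeries R) ^ n) v = 0 := by
  induction n with
  | zero => intro v hv _; rw [pow_zero_apply, if_neg hv]
  | succ n ih =>
    intro v hv hi
    rw [pow_succ_eq, mul_apply]
    refine Finset.sum_eq_zero fun k _ => ?_
    have : v.drop k ≠ [i] := fun h => hi (List.mem_of_mem_drop (i := k) (by rw [h]; simp))
    rw [letter, if_neg this, mul_zero]

end Algebra

section ExpLog

variable (R : Type*) [CommRing R] [Algebra ℚ R]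

/-- The finite product `e^{x_1} e^{x_2} ⋯ e^{x_N}`. -/
noncomputable def expProd : ℕ → NCSeries R
  | 0 => 1
  | N + 1 => expProd N * subst (PowerSeries.exp R) (letter N.succPNat)

/-- The largest index of a letter of `w` (`0` for the empty word). -/
def maxLetter (w : List ℕ+) : ℕ := (w.map PNat.val).foldr max 0

/-- The infinite ordered product `e^{x_1} e^{x_2} e^{x_3} ⋯`. The coefficient of `w` in
`e^{x_1} ⋯ e^{x_N}` does not depend on `N` once `x_1, …, x_N` contain all letters of `w`
(see `expProd_apply`), and it is the coefficient of `w` in the infinite product. -/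
noncomputable def sigmaHat : NCSeries R := fun w => expProd R (maxLetter w) w

variable {R}

theorem le_maxLetter (w : List ℕ+) : ∀ a ∈ w, (a : ℕ) ≤ maxLetter w := by
  induction w with
  | nil => simp
  | cons b w ih =>
    intro a ha
    simp only [maxLetter, List.map_cons, List.foldr_cons] at ih ⊢
    rcases List.mem_cons.1 ha with rfl | h
    · exact le_max_left _ _
    · exact (ih a h).trans (le_max_right _ _)

theorem exp_letter_nil (i : ℕ+) :
    subst (PowerSeries.exp R) (letter i) [] = 1 := by
  rw [subst, finsum_eq_single _ 0]
  · rw [pow_zero_apply]; simp [PowerSeries.coeff_exp]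
  · intro n hn
    rw [pow_apply_eq_zero _ (by simp [letter]) n [] (by simpa using Nat.pos_of_ne_zero hn),
      mul_zero]

theorem exp_letter_apply (i : ℕ+) (v : List ℕ+) (hv : v ≠ []) (hi : i ∉ v) :
    subst (PowerSeries.exp R) (letter i) v = 0 := by
  rw [subst]
  simp [letter_pow_apply_eq_zero i _ v hv hi]

/-- The coefficients of the finite products `e^{x_1} ⋯ e^{x_N}` are eventually constant, so that
`sigmaHat` is their coefficientwise limit. -/
theorem expProd_apply (w : List ℕ+) (N : ℕ) (hN : maxLetter w ≤ N) :
    expProd R N w = sigmaHat R w := by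
  induction N, hN using Nat.le_induction with
  | base => rfl
  | succ N hN ih =>
    rw [← ih, expProd]
    refine mul_apply_eq_left _ _ _ (exp_letter_nil _) fun v hv hvw =>
      exp_letter_apply _ _ hv fun h => ?_
    have := le_maxLetter w _ (hvw _ h)
    simp only [Nat.succPNat_coe] at this
    omega

variable (R)

/-- The Hausdorff series `Φ = log (e^{x_1} e^{x_2} ⋯)`, where
`log S = ∑_{n ≥ 1} (-1)^(n-1) / n * (S - 1)^n`. -/
noncomputable def hausdorff : NCSeries R := subst (PowerSeries.log R) (sigmaHat R - 1)

end ExpLog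

end NCSeries

/-- The packed word of `w`: if `b_1 < ⋯ < b_r` are the letters that occur in `w`, each `b_i` is
replaced by `i`, which is one plus the number of letters of `w` smaller than `b_i`. -/
def pack (w : List ℕ+) : List ℕ+ :=
  w.map fun b => Nat.succPNat (w.toFinset.filter (· < b)).card

/-- Packed words. -/
def PackedWord : Type := {u : List ℕ+ // pack u = u}

/-- The element `M_u`, the sum of all words `w` with `pack w = u`. -/
def mBasis (R : Type*) [CommRing R] (u : PackedWord) : NCSeries R :=
  fun w => if pack w = u.1 then 1 else 0

/-- The formal sum `∑_u c_u M_u` over all packed words. For each word only one term has a non-zero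
coefficient. -/
noncomputable def mSum {R : Type*} [CommRing R] (c : PackedWord → R) : NCSeries R :=
  fun w => ∑ᶠ u : PackedWord, c u * mBasis R u w

/-- The number of (strict) descents of a word. -/
def descents {α : Type*} [LinearOrder α] (w : List α) : ℕ :=
  (w.zip w.tail).countP fun p => p.2 < p.1

/-- The number of (strict) rises of a word. -/
def rises {α : Type*} [LinearOrder α] (w : List α) : ℕ :=
  (w.zip w.tail).countP fun p => p.1 < p.2

/-- The homogeneous Eulerian polynomial `E_n(x, y) = ∑_σ x^{d(σ)} y^{r(σ)}`, the sum over all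
permutations `σ` of `n` letters; it is homogeneous of degree `n - 1` for `n ≥ 1`. -/
def eulerianHom {R : Type*} [CommSemiring R] (n : ℕ) (x y : R) : R :=
  ∑ σ : Equiv.Perm (Fin n), x ^ descents (List.ofFn σ) * y ^ rises (List.ofFn σ)

/-- The lengths `j_1, …, j_s` of the maximal blocks of identical consecutive letters of a word. -/
def blockLengths (u : List ℕ+) : List ℕ := (u.splitBy fun a b => a == b).map List.length

/-- `t^{d(u)+1} (1+t)^{r(u)} ∏_k E_{j_k}(t, 1+t) / j_k!`. -/
noncomputable def goldbergPoly (u : List ℕ+) (t : ℝ) : ℝ :=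
  t ^ (descents u + 1) * (1 + t) ^ rises u *
    ((blockLengths u).map fun j => eulerianHom j t (1 + t) / (j.factorial : ℝ)).prod

/-! Put F = σ̂ - 1 and consider the resolvent G_t = ∑ t^n F^n = (1 - tF)⁻¹. Its coefficient at a
nonempty word w is a polynomial in t without constant term, and integrating it against dm replaces
t^n by f_n, which yields the coefficient of w in f(F). So it suffices that G_t(w) be `goldbergPoly w
t`; the Hausdorff series is the case dm = dt/t on [-1, 0].

Since G_t = 1 + t G_t F, the values G_t(w) are determined by a recursion over the cuts w = uv with v
nonempty. The closed form obeys the same recursion (`goldbergPolyOne_eq_sum`), by induction on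
maximal blocks. Indeed σ̂(v) is ∏ 1/j_k! over the blocks of v if v is weakly increasing, and 0
otherwise. Hence a last block of length j multiplies G_t by 1 + t after a rise, by t after a descent
or at the start, and by a factor e_j(t) depending only on j, with 1 + t ∑ e_j z^j = 1/(1 - t(e^z -
1)).

That e_j = E_j(t, 1 + t)/j! is the Eulerian generating function. Inserting the largest letter into a
permutation gives a differential recursion (`eulerianHom_succ_polynomial`), and the binomial form of
the generating function follows by induction (`X_mul_sum_choose_fubiniPoly`). -/

/-! ### Maximal blocks of a word -/

open List in
theorem exists_eq_append_replicate {α : Type*} [DecidableEq α] (w : List α) (hw : w ≠ []) :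
    ∃ (v : List α) (a : α) (j : ℕ), w = v ++ replicate (j + 1) a ∧ v.getLast? ≠ some a := by
  induction w using List.reverseRecOn with
  | nil => exact absurd rfl hw
  | append_singleton w a ih =>
    rcases eq_or_ne w [] with rfl | h
    · exact ⟨[], a, 0, by simp⟩
    · obtain ⟨v, b, j, rfl, hv⟩ := ih h
      rcases eq_or_ne b a with rfl | hba
      · exact ⟨v, b, j + 1, by rw [replicate_succ' (n := j + 1), append_assoc], hv⟩
      · refine ⟨v ++ replicate (j + 1) b, a, 0, by simp, ?_⟩
        rw [replicate_succ', ← append_assoc, getLast?_concat]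
        simpa using hba

/-- Induction on words by adding maximal blocks of equal letters at the end. -/
theorem block_induction {α : Type*} [DecidableEq α] {P : List α → Prop} (nil : P [])
    (append : ∀ (w : List α) (a : α) (j : ℕ), w.getLast? ≠ some a → P w →
      P (w ++ List.replicate (j + 1) a)) (w : List α) : P w := by
  induction h : w.length using Nat.strong_induction_on generalizing w with
  | _ n ih =>
    rcases eq_or_ne w [] with rfl | hw
    · exact nil
    · obtain ⟨v, a, j, rfl, hv⟩ := exists_eq_append_replicate w hw
      exact append v a j hv (ih _ (by simp at h; omega) v rfl)

/-! ### Coefficients of σ̂ -/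

namespace NCSeries

variable {R : Type*} [CommRing R]

theorem sub_one_apply (F : NCSeries R) (w : List ℕ+) :
    (F - 1) w = F w - if w = [] then 1 else 0 := rfl

theorem letter_pow_apply (i : ℕ+) (n : ℕ) (v : List ℕ+) :
    ((letter i : NCSeries R) ^ n) v = if v = List.replicate n i then 1 else 0 := by
  induction n generalizing v with
  | zero => rw [pow_zero_apply]; rfl
  | succ n ih =>
    rw [pow_succ_eq, mul_apply]
    split_ifs with h
    · subst h
      rw [Finset.sum_eq_single n]
      · simp [ih, letter]
      · intro k hk hkn
        rw [letter, if_neg, mul_zero]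
        intro h
        have := congrArg List.length h
        simp at this
        omega
      · simp
    · refine Finset.sum_eq_zero fun k _ => ?_
      rw [ih, letter]
      by_cases h1 : v.take k = List.replicate n i
      · rw [if_pos h1, if_neg, mul_zero]
        intro h2
        exact h (by rw [← List.take_append_drop k v, h1, h2, List.replicate_succ'])
      · rw [if_neg h1, zero_mul]

variable [Algebra ℚ R]

theorem exp_letter_eq (i : ℕ+) (v : List ℕ+) :
    subst (PowerSeries.exp R) (letter i) v =
      if v = List.replicate v.length i then algebraMap ℚ R (1 / v.length.factorial) else 0 := by
  rw [subst, finsum_eq_single _ v.length]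
  · rw [letter_pow_apply, PowerSeries.coeff_exp]; split_ifs <;> simp
  · intro n hn
    rw [letter_pow_apply, if_neg, mul_zero]
    intro h
    exact hn (by simpa using (congrArg List.length h).symm)

theorem expProd_eq_zero (N : ℕ) : ∀ w : List ℕ+, (∃ a ∈ w, N < (a : ℕ)) → expProd R N w = 0 := by
  induction N with
  | zero =>
    rintro w ⟨a, ha, -⟩
    rw [expProd, one_apply, if_neg (List.ne_nil_of_mem ha)]
  | succ N ih =>
    rintro w ⟨a, ha, haN⟩
    rw [expProd, mul_apply]
    refine Finset.sum_eq_zero fun k _ => ?_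
    rw [← List.take_append_drop k w, List.mem_append] at ha
    rcases ha with ha | ha
    · rw [ih _ ⟨a, ha, by omega⟩, zero_mul]
    · rw [exp_letter_eq, if_neg, mul_zero]
      intro h
      rw [h] at ha
      have := List.eq_of_mem_replicate ha
      subst this
      simp at haN

/-- Only the cut at the end of `v` survives: an earlier one puts the last letter of `v`, which is
not x_{N+1}, into the last exponential; a later one leaves x_{N+1} to the first N factors. For `j =
0`, the last factor is invisible to words not ending in x_{N+1}. -/
theorem expProd_succ_append_replicate (N j : ℕ) (v : List ℕ+)
    (hv : v.getLast? ≠ some N.succPNat) :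
    expProd R (N + 1) (v ++ List.replicate j N.succPNat) =
      expProd R N v * algebraMap ℚ R (1 / j.factorial) := by
  rw [expProd, mul_apply, Finset.sum_eq_single v.length]
  · simp [exp_letter_eq]
  · intro k hk hkv
    rcases lt_or_gt_of_ne hkv with h | h
    · rw [exp_letter_eq, if_neg, mul_zero]
      intro h1
      have hd : v.drop k ≠ [] := by simpa using h
      obtain ⟨u, b, hub⟩ := List.eq_nil_or_concat' (v.drop k) |>.resolve_left hd
      have hb : b ∈ (v ++ List.replicate j N.succPNat).drop k := by
        rw [List.drop_append_of_le_length h.le, hub]; simp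
      rw [h1] at hb
      apply hv
      rw [← List.take_append_drop k v, hub, ← List.append_assoc, List.getLast?_concat,
        List.eq_of_mem_replicate hb]
    · rw [expProd_eq_zero, zero_mul]
      refine ⟨N.succPNat, ?_, by simp⟩
      simp only [List.length_append, List.length_replicate, Finset.mem_range] at hk
      rw [List.take_append]
      simp
      right
      omega
  · simp

theorem expProd_append_replicate (a : ℕ+) (j : ℕ) (v : List ℕ+) (hv : v.getLast? ≠ some a) (N : ℕ)
    (ha : (a : ℕ) ≤ N) :
    expProd R N (v ++ List.replicate (j + 1) a) =
      if ∀ b ∈ v.getLast?, b < a then expProd R N v * algebraMap ℚ R (1 / (j + 1).factorial)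
      else 0 := by
  induction N with
  | zero => exact absurd ha (by simp)
  | succ N ih =>
    rcases eq_or_ne a N.succPNat with rfl | haN
    · rw [expProd_succ_append_replicate _ _ _ hv]
      have h0 := expProd_succ_append_replicate (R := R) N 0 v hv
      simp only [List.replicate_zero, List.append_nil, Nat.factorial_zero, Nat.cast_one, div_one,
        map_one, mul_one] at h0
      rw [h0]
      split_ifs with h
      · rfl
      · push Not at h
        obtain ⟨b, hb, hab⟩ := h
        rw [expProd_eq_zero, zero_mul]
        refine ⟨b, List.mem_of_getLast? hb, ?_⟩
        have : (N.succPNat : ℕ) ≤ b := hab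
        simp at this
        omega
    · have haN' : (a : ℕ) ≤ N := by
        have : (a : ℕ) ≠ N + 1 := fun h => haN (PNat.eq (by simpa using h))
        omega
      have h1 := expProd_succ_append_replicate (R := R) N 0 (v ++ List.replicate (j + 1) a)
        (by rw [List.replicate_succ', ← List.append_assoc, List.getLast?_concat]; simpa using haN)
      simp only [List.replicate_zero, List.append_nil, Nat.factorial_zero, Nat.cast_one, div_one,
        map_one, mul_one] at h1
      rw [h1, ih haN']
      split_ifs with h
      · have h0 := expProd_succ_append_replicate (R := R) N 0 v (by
          intro hl
          have : N.succPNat < a := h _ hl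
          have : (N.succPNat : ℕ) < a := this
          simp at this
          omega)
        simp only [List.replicate_zero, List.append_nil, Nat.factorial_zero, Nat.cast_one, div_one,
          map_one, mul_one] at h0
        rw [h0]
      · rfl

theorem sigmaHat_nil : sigmaHat R [] = 1 := rfl

theorem sigmaHat_append_replicate (a : ℕ+) (j : ℕ) (v : List ℕ+) (hv : v.getLast? ≠ some a) :
    sigmaHat R (v ++ List.replicate (j + 1) a) =
      if ∀ b ∈ v.getLast?, b < a then sigmaHat R v * algebraMap ℚ R (1 / (j + 1).factorial)
      else 0 := by
  set N := maxLetter (v ++ List.replicate (j + 1) a) + maxLetter v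
  rw [← expProd_apply _ N (by omega), ← expProd_apply v N (by omega)]
  refine expProd_append_replicate a j v hv N ?_
  have := le_maxLetter (v ++ List.replicate (j + 1) a) a (by simp)
  omega

/-- The block recursion for σ̂ only compares letters, so the coefficient depends only on their
relative order. This is what makes it constant on packing classes. -/
theorem sigmaHat_map (φ : ℕ+ → ℕ+) (w : List ℕ+) (hφ : ∀ a ∈ w, ∀ b ∈ w, a < b → φ a < φ b) :
    sigmaHat R (w.map φ) = sigmaHat R w := by
  induction w using block_induction with
  | nil => rfl
  | append w a j hw ih =>
    have hlt : ∀ b ∈ w.getLast?, (φ b < φ a ↔ b < a) ∧ φ b ≠ φ a := by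
      intro b hb
      have hbw : b ∈ w := List.mem_of_getLast? hb
      have hba : b ≠ a := by rintro rfl; exact hw hb
      rcases lt_or_gt_of_ne hba with h | h
      · have := hφ b (by simp [hbw]) a (by simp) h
        exact ⟨by simp [h, this], this.ne⟩
      · have := hφ a (by simp) b (by simp [hbw]) h
        exact ⟨iff_of_false this.not_gt h.not_gt, this.ne'⟩
    rw [List.map_append, List.map_replicate, sigmaHat_append_replicate _ _ _ hw,
      sigmaHat_append_replicate, ih fun a ha b hb => hφ a (by simp [ha]) b (by simp [hb])]
    · congr 1
      simp only [List.getLast?_map, Option.mem_def, Option.map_eq_some_iff, eq_iff_iff]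
      constructor
      · intro h b hb
        exact (hlt b hb).1.1 (h _ ⟨b, hb, rfl⟩)
      · rintro h _ ⟨b, hb, rfl⟩
        exact (hlt b hb).1.2 (h b hb)
    · intro h
      rw [List.getLast?_map, Option.map_eq_some_iff] at h
      obtain ⟨b, hb, hba⟩ := h
      exact (hlt b hb).2 hba

theorem sigmaHat_sub_one_pow_map (φ : ℕ+ → ℕ+) (n : ℕ) (w : List ℕ+)
    (hφ : ∀ a ∈ w, ∀ b ∈ w, a < b → φ a < φ b) :
    ((sigmaHat R - 1) ^ n) (w.map φ) = ((sigmaHat R - 1) ^ n) w := by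
  induction n generalizing w with
  | zero => simp [pow_zero_apply]
  | succ n ih =>
    rw [pow_succ_eq, mul_apply, mul_apply, List.length_map]
    refine Finset.sum_congr rfl fun k _ => ?_
    rw [← List.map_take, ← List.map_drop, ih _ fun a ha b hb =>
      hφ a (List.mem_of_mem_take ha) b (List.mem_of_mem_take hb), sub_one_apply, sub_one_apply,
      sigmaHat_map _ _ fun a ha b hb => hφ a (List.mem_of_mem_drop ha) b (List.mem_of_mem_drop hb)]
    simp

end NCSeries

/-! ### Packing and expansions in the M_u -/

theorem pack_strictMono (w : List ℕ+) (a b : ℕ+) (ha : a ∈ w) (hab : a < b) :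
    Nat.succPNat (w.toFinset.filter (· < a)).card <
      Nat.succPNat (w.toFinset.filter (· < b)).card := by
  rw [Nat.succPNat_lt_succPNat]
  refine Finset.card_lt_card ⟨fun x hx => ?_, fun h => ?_⟩
  · simp only [Finset.mem_filter] at hx ⊢
    exact ⟨hx.1, hx.2.trans hab⟩
  · have := h (Finset.mem_filter.2 ⟨List.mem_toFinset.2 ha, hab⟩)
    simp at this

theorem pack_pack (w : List ℕ+) : pack (pack w) = pack w := by
  set φ : ℕ+ → ℕ+ := fun b => Nat.succPNat (w.toFinset.filter (· < b)).card with hφ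
  have hlt : ∀ a ∈ w, ∀ b ∈ w, (φ a < φ b ↔ a < b) := by
    intro a ha b hb
    rcases lt_trichotomy a b with h | rfl | h
    · simp [h, pack_strictMono w a b ha h, hφ]
    · simp
    · have : φ b < φ a := pack_strictMono w b a hb h
      exact iff_of_false this.not_gt h.not_gt
  have hp : pack w = w.map φ := rfl
  rw [hp, pack, List.map_map]
  refine List.map_congr_left fun b hb => ?_
  simp only [Function.comp]
  conv_rhs => rw [hφ]
  congr 1
  have : ((w.map φ).toFinset.filter (· < φ b)) = (w.toFinset.filter (· < b)).image φ := by
    ext x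
    simp only [Finset.mem_filter, List.mem_toFinset, List.mem_map, Finset.mem_image]
    constructor
    · rintro ⟨⟨a, ha, rfl⟩, h⟩
      exact ⟨a, ⟨ha, (hlt a ha b hb).1 h⟩, rfl⟩
    · rintro ⟨a, ⟨ha, h⟩, rfl⟩
      exact ⟨⟨a, ha, rfl⟩, (hlt a ha b hb).2 h⟩
  rw [this]
  refine Finset.card_image_of_injOn fun x hx y hy hxy => ?_
  simp only [Finset.coe_filter, List.mem_toFinset, Set.mem_ofPred_eq] at hx hy
  by_contra hne
  rcases lt_or_gt_of_ne hne with h | h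
  · exact ((hlt x hx.1 y hy.1).2 h).ne hxy
  · exact ((hlt y hy.1 x hx.1).2 h).ne' hxy

theorem NCSeries.sigmaHat_sub_one_pow_pack {R : Type*} [CommRing R] [Algebra ℚ R] (n : ℕ)
    (w : List ℕ+) : ((sigmaHat R - 1) ^ n) (pack w) = ((sigmaHat R - 1) ^ n) w :=
  sigmaHat_sub_one_pow_map _ n w fun a ha b _ hab => pack_strictMono w a b ha hab

theorem mSum_apply {R : Type*} [CommRing R] (c : PackedWord → R) (w : List ℕ+) :
    mSum c w = c ⟨pack w, pack_pack w⟩ := by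
  rw [mSum, finsum_eq_single _ ⟨pack w, pack_pack w⟩]
  · simp [mBasis]
  · intro u hu
    rw [mBasis, if_neg fun h => hu (Subtype.ext h.symm), mul_zero]

theorem mSum_apply_packed {R : Type*} [CommRing R] (c : PackedWord → R) (u : PackedWord) :
    mSum c u.1 = c u := by
  rw [mSum_apply]
  exact congrArg c (Subtype.ext u.2)

/-- Each word occurs in exactly one M_u, and u occurs in M_u, so c_u is forced to be the coefficient
of u. -/
theorem existsUnique_mSum {R : Type*} [CommRing R] (F : NCSeries R)
    (hF : ∀ w, F (pack w) = F w) : ∃! c : PackedWord → R, F = mSum c := by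
  refine ⟨fun u => F u.1, ?_, ?_⟩
  · funext w
    rw [mSum_apply, hF]
  · rintro c rfl
    funext u
    exact (mSum_apply_packed c u).symm

/-! ### Descents, rises and blocks of an extended word -/

theorem descents_cons_cons {α : Type*} [LinearOrder α] (a b : α) (l : List α) :
    descents (a :: b :: l) = descents (b :: l) + if b < a then 1 else 0 := by
  simp [descents, List.countP_cons]

theorem rises_cons_cons {α : Type*} [LinearOrder α] (a b : α) (l : List α) :
    rises (a :: b :: l) = rises (b :: l) + if a < b then 1 else 0 := by
  simp [rises, List.countP_cons]

theorem descents_append_pair {α : Type*} [LinearOrder α] (l : List α) (a b : α) :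
    descents (l ++ [a] ++ [b]) = descents (l ++ [a]) + if b < a then 1 else 0 := by
  induction l with
  | nil => simp [descents_cons_cons]; simp [descents]
  | cons x l ih =>
    cases l with
    | nil => simp [descents_cons_cons]; simp [descents]; omega
    | cons y l =>
      simp only [List.cons_append, descents_cons_cons] at ih ⊢
      rw [ih]; omega

theorem rises_append_pair {α : Type*} [LinearOrder α] (l : List α) (a b : α) :
    rises (l ++ [a] ++ [b]) = rises (l ++ [a]) + if a < b then 1 else 0 := by
  induction l with
  | nil => simp [rises_cons_cons]; simp [rises]
  | cons x l ih =>
    cases l with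
    | nil => simp [rises_cons_cons]; simp [rises]; omega
    | cons y l =>
      simp only [List.cons_append, rises_cons_cons] at ih ⊢
      rw [ih]; omega

theorem descents_append_replicate {α : Type*} [LinearOrder α] (l : List α) (a b : α) (j : ℕ) :
    descents (l ++ [a] ++ List.replicate (j + 1) b) =
      descents (l ++ [a]) + if b < a then 1 else 0 := by
  induction j with
  | zero => exact descents_append_pair l a b
  | succ j ih =>
    rw [← ih, List.replicate_succ', List.replicate_succ', ← List.append_assoc, ← List.append_assoc,
      descents_append_pair]
    simp

theorem rises_append_replicate {α : Type*} [LinearOrder α] (l : List α) (a b : α) (j : ℕ) :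
    rises (l ++ [a] ++ List.replicate (j + 1) b) =
      rises (l ++ [a]) + if a < b then 1 else 0 := by
  induction j with
  | zero => exact rises_append_pair l a b
  | succ j ih =>
    rw [← ih, List.replicate_succ', List.replicate_succ', ← List.append_assoc, ← List.append_assoc,
      rises_append_pair]
    simp

theorem descents_replicate {α : Type*} [LinearOrder α] (a : α) (j : ℕ) :
    descents (List.replicate (j + 1) a) = 0 := by
  induction j with
  | zero => simp [descents]
  | succ j ih => rw [List.replicate_succ, List.replicate_succ, descents_cons_cons,
      ← List.replicate_succ, ih]; simp

theorem rises_replicate {α : Type*} [LinearOrder α] (a : α) (j : ℕ) :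
    rises (List.replicate (j + 1) a) = 0 := by
  induction j with
  | zero => simp [rises]
  | succ j ih => rw [List.replicate_succ, List.replicate_succ, rises_cons_cons,
      ← List.replicate_succ, ih]; simp

theorem blockLengths_append_replicate (v : List ℕ+) (a : ℕ+) (j : ℕ) (hv : v.getLast? ≠ some a) :
    blockLengths (v ++ List.replicate (j + 1) a) = blockLengths v ++ [j + 1] := by
  have h : (List.replicate (j + 1) a).splitBy (fun a b => a == b) = [List.replicate (j + 1) a] := by
    refine List.splitBy_of_isChain (by simp) ?_
    exact List.isChain_replicate_of_rel _ (by simp)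
  rw [blockLengths, List.splitBy_append, h]
  · simp [blockLengths]
  · intro x hx y hy
    rw [List.replicate_succ, List.head?_cons, Option.mem_some] at hy
    subst hy
    simp only [beq_eq_false_iff_ne]
    rintro rfl
    exact hv hx

theorem blockLengths_nil : blockLengths [] = [] := by simp [blockLengths]

theorem descents_map {α β : Type*} [LinearOrder α] [LinearOrder β] {f : α → β} (hf : StrictMono f)
    (l : List α) : descents (l.map f) = descents l := by
  induction l with
  | nil => rfl
  | cons a l ih =>
    cases l with
    | nil => rfl
    | cons b l =>
      simp only [List.map_cons] at ih ⊢
      rw [descents_cons_cons, descents_cons_cons, ih]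
      simp [hf.lt_iff_lt]

theorem rises_map {α β : Type*} [LinearOrder α] [LinearOrder β] {f : α → β} (hf : StrictMono f)
    (l : List α) : rises (l.map f) = rises l := by
  induction l with
  | nil => rfl
  | cons a l ih =>
    cases l with
    | nil => rfl
    | cons b l =>
      simp only [List.map_cons] at ih ⊢
      rw [rises_cons_cons, rises_cons_cons, ih]
      simp [hf.lt_iff_lt]

/-! ### Eulerian polynomials by insertion of the largest letter -/

/-- The sum of `x ^ d(l) * y ^ r(l)` over a list of words. -/
def descentSum {R : Type*} [CommSemiring R] (x y : R) (L : List (List ℕ)) : R :=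
  (L.map fun l => x ^ descents l * y ^ rises l).sum

section Eulerian
variable {R : Type*} [CommSemiring R] (x y : R)

theorem pow_descents_mul_pow_rises_cons (a b : ℕ) (l : List ℕ) (hab : a ≠ b) :
    x ^ descents (a :: b :: l) * y ^ rises (a :: b :: l) =
      (if b < a then x else y) * (x ^ descents (b :: l) * y ^ rises (b :: l)) := by
  rw [descents_cons_cons, rises_cons_cons]
  rcases lt_or_gt_of_ne hab with h | h
  · simp [h, h.not_gt, pow_succ]; ring
  · simp [h, h.not_gt, pow_succ]; ring

/-- These are the insertions of the maximum `M` anywhere but in front: inside a rise it adds a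
descent, inside a descent or at the end it adds a rise. -/
theorem descentSum_permutations'Aux_tail (M a : ℕ) (l : List ℕ) (hM : ∀ b ∈ a :: l, b < M)
    (hnd : (a :: l).Nodup) :
    descentSum x y ((List.permutations'Aux M l).map (List.cons a)) =
      x ^ descents (a :: l) * y ^ rises (a :: l) *
        (x * rises (a :: l) + y * (1 + descents (a :: l))) := by
  induction l generalizing a with
  | nil =>
    have : a < M := hM a (by simp)
    simp [descentSum, descents, rises, this, this.le]
  | cons b l ih =>
    have haM : a < M := hM a (by simp)
    have hbM : b < M := hM b (by simp)
    have hab : a ≠ b := by rintro rfl; simp at hnd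
    have ih := ih b (fun c hc => hM c (List.mem_cons_of_mem _ hc)) hnd.of_cons
    have key : descentSum x y (((List.permutations'Aux M l).map (List.cons b)).map (List.cons a)) =
        (if b < a then x else y) * descentSum x y ((List.permutations'Aux M l).map (List.cons b)) := by
      simp only [descentSum, List.map_map, Function.comp_def, pow_descents_mul_pow_rises_cons x y a b _ hab,
        List.sum_map_mul_left]
    rw [List.permutations'Aux, List.map_cons]
    rw [show ∀ (l₀ : List ℕ) L, descentSum x y (l₀ :: L) =
      x ^ descents l₀ * y ^ rises l₀ + descentSum x y L from fun _ _ => by simp [descentSum],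
      key, ih, pow_descents_mul_pow_rises_cons x y a M _ haM.ne, pow_descents_mul_pow_rises_cons x y M b _ hbM.ne',
      pow_descents_mul_pow_rises_cons x y a b _ hab, if_neg haM.not_gt, if_pos hbM, descents_cons_cons a,
      rises_cons_cons a]
    rcases lt_or_gt_of_ne hab with h | h
    · simp [h, h.not_gt]; ring
    · simp [h, h.not_gt]; ring

theorem descentSum_permutations'Aux (M : ℕ) (l : List ℕ) (hl : l ≠ []) (hM : ∀ b ∈ l, b < M)
    (hnd : l.Nodup) :
    descentSum x y (List.permutations'Aux M l) =
      x ^ descents l * y ^ rises l * (x * (1 + rises l) + y * (1 + descents l)) := by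
  obtain ⟨a, l, rfl⟩ := List.exists_cons_of_ne_nil hl
  have haM : a < M := hM a (by simp)
  have := descentSum_permutations'Aux_tail x y M a l hM hnd
  rw [List.permutations'Aux]
  rw [show ∀ (l₀ : List ℕ) L, descentSum x y (l₀ :: L) =
      x ^ descents l₀ * y ^ rises l₀ + descentSum x y L from fun _ _ => by simp [descentSum],
      this, pow_descents_mul_pow_rises_cons x y M a _ haM.ne', if_pos haM]
  ring

/-- The list `[n - 1, …, 1, 0]`. -/
def downList : ℕ → List ℕ
  | 0 => []
  | n + 1 => n :: downList n

theorem mem_downList (n b : ℕ) : b ∈ downList n ↔ b < n := by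
  induction n with
  | zero => simp [downList]
  | succ n ih => simp [downList, ih]; omega

theorem nodup_downList (n : ℕ) : (downList n).Nodup := by
  induction n with
  | zero => simp [downList]
  | succ n ih => simp [downList, ih, mem_downList]

theorem length_downList (n : ℕ) : (downList n).length = n := by
  induction n with
  | zero => simp [downList]
  | succ n ih => simp [downList, ih]

/-- `permutations'` inserts the head into the permutations of the tail, so the decreasing list makes
each insertion that of a maximum. -/
theorem eulerianHom_eq_descentSum (n : ℕ) :
    eulerianHom n x y = descentSum x y (downList n).permutations' := by
  have hnd : (downList n).permutations'.Nodup :=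
    (List.permutations_perm_permutations' _).nodup_iff.1
      (List.nodup_permutations _ (nodup_downList n))
  rw [descentSum, ← List.sum_toFinset _ hnd, eulerianHom]
  have hmap : ∀ σ : Equiv.Perm (Fin n), List.ofFn (fun i => ((σ i : Fin n) : ℕ)) =
      (List.ofFn σ).map Fin.val := fun σ => by rw [List.map_ofFn]; rfl
  refine Finset.sum_bij (fun σ _ => List.ofFn fun i => ((σ i : Fin n) : ℕ)) ?_ ?_ ?_ ?_
  · intro σ _
    rw [List.mem_toFinset, List.mem_permutations', List.perm_ext_iff_of_nodup _ (nodup_downList n)]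
    · intro b
      rw [mem_downList, List.mem_ofFn]
      constructor
      · rintro ⟨i, rfl⟩; exact (σ i).2
      · intro hb; exact ⟨σ.symm ⟨b, hb⟩, by simp⟩
    · rw [List.nodup_ofFn]
      exact Fin.val_injective.comp σ.injective
  · intro σ _ τ _ h
    ext i
    exact congrFun (List.ofFn_injective h) i
  · intro l hl
    rw [List.mem_toFinset, List.mem_permutations'] at hl
    have hlen : l.length = n := by rw [hl.length_eq, length_downList]
    have hlnd : l.Nodup := hl.nodup_iff.2 (nodup_downList n)
    subst hlen
    have hb : ∀ i : Fin l.length, l.get i < l.length := fun i =>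
      (mem_downList _ _).1 (hl.subset (List.get_mem _ _))
    have hinj : Function.Injective (fun i : Fin l.length => (⟨l.get i, hb i⟩ : Fin l.length)) :=
      fun i j hij => List.nodup_iff_injective_get.1 hlnd (Fin.mk.inj hij)
    refine ⟨Equiv.ofBijective _ (Finite.injective_iff_bijective.1 hinj), Finset.mem_univ _, ?_⟩
    simp only [Equiv.ofBijective_apply]
    exact List.ofFn_get l
  · intro σ _
    rw [hmap, descents_map Fin.val_strictMono, rises_map Fin.val_strictMono]

end Eulerian

/-! ### Recurrences for E_n(t, 1 + t) -/

-- Inserting the maximum multiplies x^d y^r by x(1 + r) + y(1 + d); at x = X, y = 1 + X the result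
-- is the derivative of X^(d+1) (1+X)^(r+1). For `n = 0` the front and end insertions coincide,
-- hence the exclusion.
open Polynomial in
theorem eulerianHom_succ_polynomial (n : ℕ) (hn : n ≠ 0) :
    eulerianHom (n + 1) (X : ℝ[X]) (1 + X) =
      derivative ((1 + X) * (X * eulerianHom n (X : ℝ[X]) (1 + X))) := by
  rw [eulerianHom_eq_descentSum, eulerianHom_eq_descentSum]
  have hs : (1 + X) * (X * descentSum (X : ℝ[X]) (1 + X) (downList n).permutations') =
      ((downList n).permutations'.map fun l =>
        (X : ℝ[X]) ^ (descents l + 1) * (1 + X) ^ (rises l + 1)).sum := by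
    rw [descentSum, ← List.sum_map_mul_left, ← List.sum_map_mul_left]
    congr 2
    funext l
    ring
  have hd : ∀ L : List ℝ[X], derivative L.sum = (L.map derivative).sum := fun L =>
    map_list_sum derivative L
  rw [hs, hd, List.map_map, downList, List.permutations', descentSum, List.map_flatMap,
    List.flatMap, List.sum_flatten, List.map_map]
  congr 1
  refine List.map_congr_left fun l hl => ?_
  rw [List.mem_permutations'] at hl
  have h := descentSum_permutations'Aux (X : ℝ[X]) (1 + X) n l
    (by rw [← List.length_pos_iff, hl.length_eq, length_downList]; omega)
    (fun b hb => (mem_downList _ _).1 (hl.subset hb)) (hl.nodup_iff.2 (nodup_downList n))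
  simp only [descentSum] at h
  simp only [Function.comp]
  rw [h]
  simp only [derivative_mul, derivative_pow, derivative_add, derivative_one,
    derivative_X, Nat.add_sub_cancel]
  simp
  ring

theorem eulerianHom_one {R : Type*} [CommSemiring R] (x y : R) : eulerianHom 1 x y = 1 := by
  simp [eulerianHom_eq_descentSum, downList, descentSum, descents, rises]

/-- `t E_n(t, 1 + t)` for `n ≥ 1`, and `1` for `n = 0`. -/
noncomputable def fubiniPoly (n : ℕ) : Polynomial ℝ :=
  if n = 0 then 1 else Polynomial.X * eulerianHom n Polynomial.X (1 + Polynomial.X)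

open Polynomial in
theorem fubiniPoly_succ (n : ℕ) :
    fubiniPoly (n + 1) = X * derivative ((1 + X) * fubiniPoly n) := by
  rcases eq_or_ne n 0 with rfl | hn
  · simp [fubiniPoly, eulerianHom_one]
  · simp only [fubiniPoly, hn, if_false, Nat.succ_ne_zero]
    rw [eulerianHom_succ_polynomial n hn]

-- Coefficientwise form of t e^z P = (1 + t) P - 1 for P = 1/(1 - t(e^z - 1)).
open Polynomial Finset in
theorem X_mul_sum_choose_fubiniPoly (n : ℕ) :
    X * ∑ k ∈ range (n + 1), (n.choose k : ℝ[X]) * fubiniPoly k =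
      (1 + X) * fubiniPoly n - C (if n = 0 then 1 else 0) := by
  induction n with
  | zero => simp [fubiniPoly]
  | succ n ih =>
    have h := sum_choose_succ_mul (R := ℝ[X]) (fun k _ => fubiniPoly k) n
    simp only [fubiniPoly_succ] at h
    rw [show n + 1 + 1 = n + 2 from rfl, h]
    set S := ∑ k ∈ range (n + 1), (n.choose k : ℝ[X]) * fubiniPoly k with hS
    set δ : ℝ := if n = 0 then 1 else 0
    have hS' : ∑ k ∈ range (n + 1), (n.choose k : ℝ[X]) * (X * derivative ((1 + X) * fubiniPoly k))
        = X * derivative ((1 + X) * S) := by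
      rw [hS, mul_sum, derivative_sum, mul_sum]
      refine sum_congr rfl fun k _ => ?_
      simp only [derivative_mul, derivative_natCast]
      ring
    rw [hS', fubiniPoly_succ]
    have ih' := congrArg derivative ih
    simp only [derivative_mul, derivative_sub, derivative_add, derivative_X, derivative_one,
      derivative_C] at ih' ⊢
    simp only [Nat.succ_ne_zero, if_false, map_zero]
    -- After Pascal's rule, the claim is X(1 + X) times the derivative of the induction hypothesis,
    -- in which the constant δ disappears.
    linear_combination (X * (1 + X)) * ih'

open Polynomial in
theorem eval_eulerianHom (n : ℕ) (t : ℝ) :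
    eval t (eulerianHom n (X : ℝ[X]) (1 + X)) = eulerianHom n t (1 + t) := by
  simp [eulerianHom, eval_finsetSum]

open Polynomial Finset in
theorem eulerianHom_eq_sum_choose (n : ℕ) (hn : n ≠ 0) :
    eulerianHom n (X : ℝ[X]) (1 + X) = ∑ k ∈ range n, (n.choose k : ℝ[X]) * fubiniPoly k := by
  have h := X_mul_sum_choose_fubiniPoly n
  rw [sum_range_succ, Nat.choose_self, if_neg hn, map_zero] at h
  have hf : fubiniPoly n = X * eulerianHom n (X : ℝ[X]) (1 + X) := by rw [fubiniPoly, if_neg hn]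
  refine mul_left_cancel₀ (X_ne_zero (R := ℝ)) ?_
  rw [← hf]
  push_cast at h
  linear_combination -h

/-- `E_n(t, 1 + t) / n!`. -/
noncomputable def eulerFactor (t : ℝ) (n : ℕ) : ℝ := eulerianHom n t (1 + t) / (n.factorial : ℝ)

open Finset in
theorem eulerFactor_recurrence (t : ℝ) (j : ℕ) :
    eulerFactor t (j + 1) = 1 / ((j + 1).factorial : ℝ) +
      ∑ i ∈ range j, t * eulerFactor t (i + 1) * (1 / ((j - i).factorial : ℝ)) := by
  have h := congrArg (Polynomial.eval t) (eulerianHom_eq_sum_choose (j + 1) j.succ_ne_zero)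
  rw [eval_eulerianHom, Polynomial.eval_finsetSum, sum_range_succ'] at h
  rw [eulerFactor, h, add_comm, add_div, sum_div]
  congr 1
  · simp [fubiniPoly]
  · refine sum_congr rfl fun i hi => ?_
    have hi := mem_range.1 hi
    rw [fubiniPoly, if_neg i.succ_ne_zero, Nat.choose_eq_factorial_div_factorial (by omega),
      Nat.add_sub_add_right]
    simp only [Polynomial.eval_mul, Polynomial.eval_natCast, Polynomial.eval_X, eval_eulerianHom,
      eulerFactor]
    rw [Nat.cast_div]
    · push_cast
      have h1 : ((j + 1).factorial : ℝ) ≠ 0 := by positivity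
      have h2 : ((i + 1).factorial : ℝ) ≠ 0 := by positivity
      have h3 : ((j - i).factorial : ℝ) ≠ 0 := by positivity
      field_simp
    · have := Nat.factorial_mul_factorial_dvd_factorial (n := j + 1) (k := i + 1) (by omega)
      rwa [Nat.add_sub_add_right] at this
    · positivity

/-! ### The resolvent of σ̂ - 1 -/

/-- `goldbergPoly`, with the value `1` at the empty word. -/
noncomputable def goldbergPolyOne (t : ℝ) (w : List ℕ+) : ℝ :=
  if w = [] then 1 else goldbergPoly w t

/-- The extra t in t^(d+1) is charged to the first block, which therefore behaves like one following
a descent. -/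
theorem goldbergPolyOne_append_replicate (t : ℝ) (w : List ℕ+) (a : ℕ+) (j : ℕ)
    (hw : w.getLast? ≠ some a) :
    goldbergPolyOne t (w ++ List.replicate (j + 1) a) =
      goldbergPolyOne t w * (if w ≠ [] ∧ ∀ b ∈ w.getLast?, b < a then 1 + t else t) *
        eulerFactor t (j + 1) := by
  have h1 : w ++ List.replicate (j + 1) a ≠ [] := by simp
  rw [goldbergPolyOne, if_neg h1, goldbergPoly, blockLengths_append_replicate _ _ _ hw]
  rcases List.eq_nil_or_concat' w with rfl | ⟨v, b, rfl⟩
  · simp [descents_replicate, rises_replicate, blockLengths_nil, eulerFactor, goldbergPolyOne]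
  · rw [descents_append_replicate, rises_append_replicate, goldbergPolyOne,
      if_neg (List.append_ne_nil_of_right_ne_nil v (List.cons_ne_nil b [])), goldbergPoly]
    have hba : b ≠ a := by simpa using hw
    rcases lt_or_gt_of_ne hba with h | h
    · simp [h, h.not_gt, eulerFactor]
      ring
    · simp [h, h.not_gt, eulerFactor]
      ring

namespace NCSeries

open Finset

/-- This is G = 1 + t G (σ̂ - 1) at a nonempty word; the suffixes are nonempty, so σ̂ - 1 may be
replaced by σ̂. -/
theorem goldbergPolyOne_eq_sum (t : ℝ) (w : List ℕ+) (hw : w ≠ []) :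
    goldbergPolyOne t w =
      t * ∑ i ∈ range w.length, goldbergPolyOne t (w.take i) * sigmaHat ℝ (w.drop i) := by
  induction w using block_induction with
  | nil => exact absurd rfl hw
  | append w a j hl ih =>
    have hrep : ∀ i, sigmaHat ℝ (List.replicate (i + 1) a) = 1 / ((i + 1).factorial : ℝ) := by
      intro i
      have := sigmaHat_append_replicate (R := ℝ) a i [] (by simp)
      simpa [sigmaHat_nil] using this
    have h2 : ∀ i ∈ range (j + 1), goldbergPolyOne t ((w ++ List.replicate (j + 1) a).take
        (w.length + i)) * sigmaHat ℝ ((w ++ List.replicate (j + 1) a).drop (w.length + i)) =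
        goldbergPolyOne t (w ++ List.replicate i a) * (1 / ((j + 1 - i).factorial : ℝ)) := by
      intro i hi
      have hi := mem_range.1 hi
      obtain ⟨k, hk⟩ : ∃ k, j + 1 - i = k + 1 := ⟨j - i, by omega⟩
      rw [List.take_length_add_append, List.drop_length_add_append, List.take_replicate,
        List.drop_replicate, min_eq_left (by omega), hk, hrep]
    -- A cut inside `w` keeps the whole last block in the suffix, so it contributes only if that
    -- block follows a rise.
    have h1 : ∀ i ∈ range w.length, goldbergPolyOne t ((w ++ List.replicate (j + 1) a).take i) *
        sigmaHat ℝ ((w ++ List.replicate (j + 1) a).drop i) =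
        if ∀ b ∈ w.getLast?, b < a then
          goldbergPolyOne t (w.take i) * sigmaHat ℝ (w.drop i) * (1 / ((j + 1).factorial : ℝ))
        else 0 := by
      intro i hi
      have hi := mem_range.1 hi
      have hlast : (w.drop i).getLast? = w.getLast? := by
        rw [List.getLast?_drop, if_neg (by omega)]
      rw [List.take_append_of_le_length hi.le, List.drop_append_of_le_length hi.le,
        sigmaHat_append_replicate _ _ _ (by rwa [hlast]), hlast]
      split_ifs
      · simp; ring
      · simp
    rw [List.length_append, List.length_replicate, sum_range_add, sum_congr rfl h1,
      sum_congr rfl h2, sum_range_succ', goldbergPolyOne_append_replicate _ _ _ _ hl]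
    have h3 : ∀ i ∈ range j, goldbergPolyOne t (w ++ List.replicate (i + 1) a) *
        (1 / ((j + 1 - (i + 1)).factorial : ℝ)) =
        goldbergPolyOne t w * (if w ≠ [] ∧ ∀ b ∈ w.getLast?, b < a then 1 + t else t) *
          (eulerFactor t (i + 1) * (1 / ((j - i).factorial : ℝ))) := by
      intro i _
      rw [goldbergPolyOne_append_replicate _ _ _ _ hl, Nat.add_sub_add_right]
      ring
    have h4 := eulerFactor_recurrence t j
    simp only [mul_assoc] at h4
    rw [← mul_sum] at h4
    rw [sum_congr rfl h3, ← mul_sum]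
    simp only [List.replicate_zero, List.append_nil, Nat.sub_zero]
    -- At a rise the cuts inside `w` give G(w)/(j+1)! by `ih`, and the cut just before the block
    -- gives t times that, whence 1 + t. Otherwise only the latter remains.
    by_cases hc : w ≠ [] ∧ ∀ b ∈ w.getLast?, b < a
    · rw [if_pos hc]
      simp only [if_pos hc.2]
      rw [← sum_mul]
      linear_combination (1 / ((j + 1).factorial : ℝ)) * ih hc.1 +
        goldbergPolyOne t w * (1 + t) * h4
    · have h5 : ∑ i ∈ range w.length, (if ∀ b ∈ w.getLast?, b < a then
          goldbergPolyOne t (w.take i) * sigmaHat ℝ (w.drop i) * (1 / ((j + 1).factorial : ℝ))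
          else 0) = 0 := by
        rcases eq_or_ne w [] with rfl | hne
        · simp
        · simp only [if_neg fun h => hc ⟨hne, h⟩, sum_const_zero]
      rw [if_neg hc, h5]
      linear_combination goldbergPolyOne t w * t * h4

/-- The generating polynomial of the coefficients of a word in the powers of `σ̂ - 1`. -/
theorem sum_pow_eq_goldbergPolyOne (t : ℝ) (w : List ℕ+) :
    ∑ n ∈ range (w.length + 1), t ^ n * ((sigmaHat ℝ - 1) ^ n) w = goldbergPolyOne t w := by
  set F : NCSeries ℝ := sigmaHat ℝ - 1 with hF
  have hF0 : F [] = 0 := by rw [hF, sub_one_apply, sigmaHat_nil]; simp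
  induction h : w.length using Nat.strong_induction_on generalizing w with
  | _ m ih =>
    rcases eq_or_ne w [] with rfl | hw
    · simp only [List.length_nil] at h
      subst h
      simp [goldbergPolyOne, pow_zero_apply]
    · rw [goldbergPolyOne_eq_sum t w hw, sum_range_succ', pow_zero_apply, if_neg hw, mul_zero,
        add_zero, h, mul_sum]
      have h1 : ∀ n ∈ range m, t ^ (n + 1) * (F ^ (n + 1)) w =
          ∑ i ∈ range m, t * (t ^ n * (F ^ n) (w.take i) * F (w.drop i)) := by
        intro n _
        rw [pow_succ_eq, mul_apply, h, sum_range_succ, ← h, List.drop_length, hF0, mul_zero,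
          add_zero, mul_sum]
        refine sum_congr rfl fun i _ => ?_
        ring
      rw [sum_congr rfl h1, sum_comm]
      refine sum_congr rfl fun i hi => ?_
      have hi := mem_range.1 hi
      have hd : w.drop i ≠ [] := by rw [Ne, List.drop_eq_nil_iff]; omega
      have hlen : (w.take i).length = i := by rw [List.length_take]; omega
      rw [← mul_sum, ← sum_mul, ← ih i hi (w.take i) hlen, hF, sub_one_apply, if_neg hd, sub_zero,
        ← hF]
      congr 2
      -- On a prefix of length i the powers F^n with n > i vanish.
      refine (sum_subset (range_subset_range.2 hi) fun n _ hn => ?_).symm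
      rw [pow_apply_eq_zero F hF0 n _ (by rw [hlen]; simpa using hn), mul_zero]

theorem goldbergPoly_eq_sum (t : ℝ) (w : List ℕ+) (hw : w ≠ []) :
    goldbergPoly w t =
      ∑ n ∈ range w.length, ((sigmaHat ℝ - 1) ^ (n + 1)) w * t ^ (n + 1) := by
  have h := sum_pow_eq_goldbergPolyOne t w
  rw [goldbergPolyOne, if_neg hw, sum_range_succ', pow_zero_apply, if_neg hw, mul_zero,
    add_zero] at h
  rw [← h]
  exact sum_congr rfl fun n _ => mul_comm _ _

/-! ### Substitution and integration against the measure -/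

theorem sigmaHat_sub_one_nil {R : Type*} [CommRing R] [Algebra ℚ R] :
    (sigmaHat R - 1) [] = 0 := by
  rw [sub_one_apply, sigmaHat_nil]; simp

theorem subst_apply {R : Type*} [CommRing R] (f : R⟦X⟧) (F : NCSeries R) (hF : F [] = 0)
    (w : List ℕ+) :
    subst f F w = ∑ n ∈ range (w.length + 1), PowerSeries.coeff n f * (F ^ n) w := by
  rw [subst, finsum_eq_sum_of_support_subset]
  intro n hn
  rw [Function.mem_support] at hn
  by_contra h
  rw [coe_range, Set.mem_Iio] at h
  exact hn (by rw [pow_apply_eq_zero F hF n w (by omega), mul_zero])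

theorem subst_sigmaHat_sub_one_pack {R : Type*} [CommRing R] [Algebra ℚ R] (f : R⟦X⟧)
    (w : List ℕ+) :
    subst f (sigmaHat R - 1) (pack w) = subst f (sigmaHat R - 1) w := by
  rw [subst, subst]
  simp only [sigmaHat_sub_one_pow_pack]

-- At a nonempty word the polynomial has no constant term, so only moments of order at least 1
-- enter; the total mass may be infinite.
open MeasureTheory in
theorem integral_goldbergPoly (μ : Measure ℝ) (ρ : ℝ → ℝ) (f : ℝ⟦X⟧)
    (hint : ∀ n : ℕ, 1 ≤ n → Integrable (fun t => t ^ n * ρ t) μ)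
    (hf : ∀ n : ℕ, 1 ≤ n → PowerSeries.coeff n f = ∫ t, t ^ n * ρ t ∂μ)
    (w : List ℕ+) (hw : w ≠ []) :
    Integrable (fun t => goldbergPoly w t * ρ t) μ ∧
      subst f (sigmaHat ℝ - 1) w = ∫ t, goldbergPoly w t * ρ t ∂μ := by
  have h : (fun t => goldbergPoly w t * ρ t) = fun t => ∑ n ∈ range w.length,
      ((sigmaHat ℝ - 1) ^ (n + 1)) w * (t ^ (n + 1) * ρ t) := by
    funext t
    rw [goldbergPoly_eq_sum t w hw, sum_mul]
    exact sum_congr rfl fun n _ => mul_assoc _ _ _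
  have hi : ∀ n ∈ range w.length, Integrable (fun t => ((sigmaHat ℝ - 1) ^ (n + 1)) w *
      (t ^ (n + 1) * ρ t)) μ := fun n _ => (hint (n + 1) (by omega)).const_mul _
  rw [h]
  refine ⟨integrable_finsetSum _ hi, ?_⟩
  rw [integral_finsetSum _ hi, subst_apply _ _ sigmaHat_sub_one_nil, sum_range_succ',
    pow_zero_apply, if_neg hw, mul_zero, add_zero]
  refine sum_congr rfl fun n _ => ?_
  rw [integral_const_mul, hf _ (by omega), mul_comm]

/-! ### Passage from ℚ to ℝ -/

section Map

variable {R S : Type*} [CommRing R] [CommRing S] (φ : R →+* S)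

theorem map_pow_apply (F : NCSeries R) (G : NCSeries S) (h : ∀ w, φ (F w) = G w) (n : ℕ)
    (w : List ℕ+) : φ ((F ^ n) w) = (G ^ n) w := by
  induction n generalizing w with
  | zero => rw [pow_zero_apply, pow_zero_apply]; split_ifs <;> simp
  | succ n ih =>
    rw [pow_succ_eq, pow_succ_eq, mul_apply, mul_apply, map_sum]
    exact sum_congr rfl fun i _ => by rw [map_mul, ih, h]

variable [Algebra ℚ R] [Algebra ℚ S]

theorem map_sigmaHat (w : List ℕ+) : φ (sigmaHat R w) = sigmaHat S w := by
  induction w using block_induction with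
  | nil => simp [sigmaHat_nil]
  | append w a j hw ih =>
    rw [sigmaHat_append_replicate _ _ _ hw, sigmaHat_append_replicate _ _ _ hw]
    split_ifs
    · rw [map_mul, ih, RingHom.map_rat_algebraMap]
    · simp

theorem map_hausdorff (w : List ℕ+) : φ (hausdorff R w) = hausdorff S w := by
  rw [hausdorff, hausdorff, subst_apply _ _ sigmaHat_sub_one_nil,
    subst_apply _ _ sigmaHat_sub_one_nil, map_sum]
  refine sum_congr rfl fun n _ => ?_
  rw [map_mul, map_pow_apply φ (sigmaHat R - 1) (sigmaHat S - 1), ← PowerSeries.map_log φ,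
    PowerSeries.coeff_map]
  intro v
  rw [sub_one_apply, sub_one_apply, map_sub, map_sigmaHat]
  split_ifs <;> simp

end Map

end NCSeries

/-! ### Moments of dt/t on [-1, 0] -/

open MeasureTheory in
theorem ae_pow_succ_mul_inv (n : ℕ) :
    (fun t : ℝ => t ^ n) =ᵐ[volume.restrict (Set.Ioc (-1) 0)] fun t => t ^ (n + 1) * t⁻¹ := by
  -- Since `0⁻¹ = 0`, the two sides differ at t = 0 when n = 0.
  have : ∀ᵐ t : ℝ ∂volume, t ≠ 0 := by simp [ae_iff]
  filter_upwards [ae_restrict_of_ae this] with t ht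
  rw [pow_succ, mul_assoc, mul_inv_cancel₀ ht, mul_one]

open MeasureTheory in
theorem integrable_pow_succ_mul_inv (n : ℕ) :
    Integrable (fun t : ℝ => t ^ (n + 1) * t⁻¹) (volume.restrict (Set.Ioc (-1) 0)) := by
  refine Integrable.congr ?_ (ae_pow_succ_mul_inv n)
  exact (intervalIntegrable_iff_integrableOn_Ioc_of_le (by norm_num)).1
    ((continuous_pow n).intervalIntegrable (-1) 0)

open MeasureTheory in
theorem coeff_log_eq_integral (n : ℕ) :
    PowerSeries.coeff (n + 1) (PowerSeries.log ℝ) =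
      ∫ t : ℝ, t ^ (n + 1) * t⁻¹ ∂(volume.restrict (Set.Ioc (-1) 0)) := by
  rw [← integral_congr_ae (ae_pow_succ_mul_inv n),
    ← intervalIntegral.integral_of_le (by norm_num), integral_pow, PowerSeries.coeff_log,
    if_neg n.succ_ne_zero]
  simp
  ring

/-- Goldberg's formula, and its generalization to a series `f` without constant term whose
coefficients are the moments `f_n = ∫ t^n dm(t)`, `n ≥ 1`, of a measure `m` on the real line, where
`f` is evaluated at `e^{x_1} e^{x_2} ⋯ - 1`. The measure is written `dm = ρ dμ` with `μ` positive, so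
that it may be signed and infinite near `0`: a positive measure is the case `ρ = 1`, and the
Hausdorff series corresponds to `dt / t` on `[-1, 0]`. -/
theorem mainTheorem3 :
    ((∃! c : PackedWord → ℚ, NCSeries.hausdorff ℚ = mSum c) ∧
      ∀ c : PackedWord → ℚ, NCSeries.hausdorff ℚ = mSum c →
        ∀ u : PackedWord, u.1 ≠ [] →
          IntervalIntegrable (fun t : ℝ => goldbergPoly u.1 t / t) MeasureTheory.volume (-1) 0 ∧
          (c u : ℝ) = ∫ t in (-1 : ℝ)..0, goldbergPoly u.1 t / t) ∧
    (∀ (μ : MeasureTheory.Measure ℝ) (ρ : ℝ → ℝ) (f : PowerSeries ℝ),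
      (∀ n : ℕ, 1 ≤ n → MeasureTheory.Integrable (fun t => t ^ n * ρ t) μ) →
      PowerSeries.constantCoeff f = 0 →
      (∀ n : ℕ, 1 ≤ n → PowerSeries.coeff n f = ∫ t, t ^ n * ρ t ∂μ) →
      (∃! c : PackedWord → ℝ, NCSeries.subst f (NCSeries.sigmaHat ℝ - 1) = mSum c) ∧
      ∀ c : PackedWord → ℝ, NCSeries.subst f (NCSeries.sigmaHat ℝ - 1) = mSum c →
        ∀ u : PackedWord, u.1 ≠ [] →
          MeasureTheory.Integrable (fun t => goldbergPoly u.1 t * ρ t) μ ∧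
          c u = ∫ t, goldbergPoly u.1 t * ρ t ∂μ) := by
  refine ⟨⟨existsUnique_mSum _ (NCSeries.subst_sigmaHat_sub_one_pack _), fun c hc u hu => ?_⟩,
    fun μ ρ f hint _ hf => ⟨existsUnique_mSum _ (NCSeries.subst_sigmaHat_sub_one_pack _),
      fun c hc u hu => ?_⟩⟩
  · have h := NCSeries.integral_goldbergPoly (MeasureTheory.volume.restrict (Set.Ioc (-1) 0))
      (fun t => t⁻¹) (PowerSeries.log ℝ)
      (fun n hn => by
        obtain ⟨n, rfl⟩ := Nat.exists_eq_add_of_le' hn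
        exact integrable_pow_succ_mul_inv n)
      (fun n hn => by
        obtain ⟨n, rfl⟩ := Nat.exists_eq_add_of_le' hn
        exact coeff_log_eq_integral n) u.1 hu
    have hc' : (c u : ℝ) = NCSeries.hausdorff ℝ u.1 := by
      rw [← mSum_apply_packed c u, ← hc]
      exact NCSeries.map_hausdorff (Rat.castHom ℝ) u.1
    rw [hc', intervalIntegrable_iff_integrableOn_Ioc_of_le (by norm_num),
      intervalIntegral.integral_of_le (by norm_num)]
    simp only [div_eq_mul_inv]
    exact h
  · rw [← mSum_apply_packed c u, ← hc]
    exact NCSeries.integral_goldbergPoly μ ρ f hint hf u.1 hu
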